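/- For every $d \in \mathbb{N}$ there exists a subgroup $H_d \leqslant \mathbb{F}_2^d$ of the $d$-th direct power of the free group $\mathbb{F}_2$ of rank $2$ such that: $H_d$ has a generating set of at most $3$ elements; $H_d$ is a subdirect product in $\mathbb{F}_2^d$, i.e. it projects onto each of the $d$ direct factors $\mathbb{F}_2$; $H_d$ contains a subgroup isomorphic to the free abelian group $\mathbb{Z}^d$ of rank $d$; and the cohomological dimension of $H_d$ over the integers (the projective dimension of the trivial $\mathbb{Z}H_d$-module $\mathbb{Z}$) equals $d$. -/

import Mathlib

/-- The cohomological dimension (over the integers) of a group `G`: the projective dimension of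
the trivial `G`-module `ℤ` in the category of `ℤ`-linear representations of `G` (equivalently, of
left modules over the integral group ring of `G`). -/
noncomputable def cohomologicalDimension (G : Type) [Group G] : WithBot ℕ∞ :=
  CategoryTheory.projectiveDimension (Rep.trivial.{0} ℤ G ℤ)

/-- A subgroup `H` of a group is `n`-generated if it has a generating set of at most `n`
elements. -/
def IsGeneratedByAtMost {G : Type*} [Group G] (H : Subgroup G) (n : ℕ) : Prop :=
  ∃ s : Finset G, s.card ≤ n ∧ Subgroup.closure (s : Set G) = H

/-- A subgroup of a direct product is a subdirect product if it projects onto each factor. -/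
def IsSubdirectProduct {ι : Type*} {F : ι → Type*} [∀ i, Group (F i)]
    (H : Subgroup (∀ i, F i)) : Prop :=
  ∀ i, H.map (Pi.evalMonoidHom F i) = ⊤

/-! Take `H` generated by the diagonal `a`, `b` and `z = (1, a, a², …)`. Since `z a⁻ʲ` is trivial in
coordinate `j` only, iterated commutators kill all coordinates but one, so `H` meets every factor
nontrivially (`exists_mulSingle_mem_freePowerSubgroup`) and contains `ℤ^d`.

Upper bound: `H` acts on `d` Cayley trees through its coordinates, freely on the product of the
vertex sets. Each tree gives a short exact sequence of permutation modules and costs at most one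
dimension (`hasProjectiveDimensionLE_perm`).

Lower bound: restriction to a subgroup keeps projective resolutions, and for `ℤ^d` splicing the
extension classes of `d` lines gives a nonzero class in `Ext^d` (`exists_ext_perm_ne_zero`). -/

open CategoryTheory CategoryTheory.Abelian

/-! ### Cayley trees of free groups -/

namespace FreeGroup

variable {α : Type*}

-- With an equivalence as the step, inverse generators need no separate case.
@[elab_as_elim]
theorem induction_mul_of {p : FreeGroup α → Prop} (one : p 1)
    (step : ∀ u i, p (u * of i) ↔ p u) (u : FreeGroup α) : p u := by
  have hu : u ∈ Subgroup.closure (Set.range (of : α → FreeGroup α)) := by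
    rw [closure_range_of]; trivial
  induction hu using Subgroup.closure_induction_right with
  | one => exact one
  | mul_right x _ y hy hx =>
    obtain ⟨i, rfl⟩ := hy
    exact (step x i).2 hx
  | mul_inv_cancel x _ y hy hx =>
    obtain ⟨i, rfl⟩ := hy
    rw [← step _ i]
    simpa using hx

/-- A cochain on the edges of the Cayley tree of a free group
is the coboundary of a function vanishing at the base point. -/
theorem exists_primitive {M : Type*} [AddCommGroup M] (c : α → FreeGroup α → M) :
    ∃ D : FreeGroup α → M, D 1 = 0 ∧ ∀ u i, D (u * of i) = D u + c i u := by
  -- `s i` walks along the edge labelled `i` and adds its value to a running total. Words grow on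
  -- the right, hence the opposite group below.
  let s (i : α) : Equiv.Perm (FreeGroup α × M) :=
    { toFun := fun p => (p.1 * of i, p.2 + c i p.1)
      invFun := fun p => (p.1 * (of i)⁻¹, p.2 - c i (p.1 * (of i)⁻¹))
      left_inv := fun p => by simp
      right_inv := fun p => by simp }
  let Φ : FreeGroup α →* (Equiv.Perm (FreeGroup α × M))ᵐᵒᵖ :=
    lift fun i => MulOpposite.op (s i)
  have hΦ (u : FreeGroup α) (i : α) : (Φ (u * of i)).unop (1, 0) = s i ((Φ u).unop (1, 0)) := by
    simp [Φ]
  have hfst (u : FreeGroup α) : ((Φ u).unop (1, 0)).1 = u := by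
    induction u using induction_mul_of with
    | one => simp
    | step u i =>
      rw [hΦ]
      simp [s]
  refine ⟨fun u => ((Φ u).unop (1, 0)).2, by simp, fun u i => ?_⟩
  simp only [hΦ]
  simp [s, hfst]

end FreeGroup

/-! ### Permutation modules and their projective dimension -/

namespace Rep

section PermRep

variable {k : Type} [CommRing k] {H : Type} [Group H]

/-- The permutation representation on the free module `k[X]`. -/
noncomputable abbrev perm (k : Type) [CommRing k] {X : Type} (σ : H →* Equiv.Perm X) : Rep.{0} k H :=
  Rep.of (X := X →₀ k)
    { toFun := fun h => Finsupp.lmapDomain k k (σ h)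
      map_one' := by ext; simp
      map_mul' := fun g h => by ext; simp }

variable {X : Type} (σ : H →* Equiv.Perm X)

theorem perm_ρ_single (h : H) (x : X) (n : k) :
    (perm k σ).ρ h (Finsupp.single x n) = Finsupp.single (σ h x) n :=
  Finsupp.mapDomain_single

/-- A morphism out of a permutation representation, given by an equivariant function. -/
noncomputable def permLift {A : Rep.{0} k H} (f : X → A.V) (hf : ∀ h x, f (σ h x) = A.ρ h (f x)) :
    perm k σ ⟶ A :=
  Rep.ofHom (ρ := (perm k σ).ρ) (σ := A.ρ) ⟨Finsupp.linearCombination k f, fun h => by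
    refine Finsupp.lhom_ext' fun x => LinearMap.ext_ring ?_
    simp [hf]⟩

@[simp]
theorem permLift_single {A : Rep.{0} k H} (f : X → A.V) (hf : ∀ h x, f (σ h x) = A.ρ h (f x))
    (x : X) (n : k) : (permLift σ f hf).hom (Finsupp.single x n) = n • f x :=
  Finsupp.linearCombination_single _ _ _

theorem perm_hom_ext {A : Rep.{0} k H} {f g : perm k σ ⟶ A}
    (hfg : ∀ x, f.hom (Finsupp.single x 1) = g.hom (Finsupp.single x 1)) : f = g := by
  ext : 2
  exact Finsupp.lhom_ext' fun x => LinearMap.ext_ring (hfg x)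

/-- The permutation representation of a free action is projective. -/
theorem projective_perm_of_free (hσ : ∀ h x, σ h x = x → h = 1) : Projective (perm k σ) where
  factors {E A} f e he := by
    let : Setoid X :=
      { r := fun x y => ∃ h, σ h y = x
        iseqv := ⟨fun x => ⟨1, by simp⟩, fun ⟨h, e⟩ => ⟨h⁻¹, by simp [← e]⟩,
          fun ⟨h, e⟩ ⟨h', e'⟩ => ⟨h * h', by simp [e', e]⟩⟩ }
    let r (x : X) : X := (Quotient.mk' x).out
    have hr (x : X) : ∃ h, σ h (r x) = x := Setoid.symm (Quotient.mk_out x)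
    choose γ hγ using hr
    have hrh (h : H) (x : X) : r (σ h x) = r x :=
      congrArg Quotient.out (Quotient.sound ⟨h, rfl⟩)
    -- Freeness makes the element carrying the orbit representative to `x` unique, so `γ` is
    -- equivariant.
    have hγh (h : H) (x : X) : γ (σ h x) = h * γ x := by
      have key := hσ ((h * γ x)⁻¹ * γ (σ h x)) (r x) (by
        have := hγ (σ h x)
        rw [hrh] at this
        rw [map_mul, Equiv.Perm.mul_apply, this, map_inv, Equiv.Perm.inv_eq_iff_eq, map_mul,
          Equiv.Perm.mul_apply, hγ])
      exact (inv_mul_eq_one.1 key).symm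
    choose s hs using (epi_iff_surjective e).1 he
    refine ⟨permLift σ (fun x => E.ρ (γ x) (s (f.hom (Finsupp.single (r x) 1)))) fun h x => ?_, ?_⟩
    · simp only [hγh, hrh, map_mul, Module.End.mul_apply]
    · refine perm_hom_ext σ fun x => ?_
      rw [hom_comp, Representation.IntertwiningMap.comp_apply, permLift_single, one_smul,
        hom_comm_apply, hs, ← hom_comm_apply, perm_ρ_single, hγ]

section Cayley

variable {ι : Type} (π : H →* FreeGroup ι)

/-- The diagonal action on the product of an `H`-set with a free group on which `H` acts by left
translation through a homomorphism. -/
def mulPerm : H →* Equiv.Perm (X × FreeGroup ι) where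
  toFun h := (σ h).prodCongr (Equiv.mulLeft (π h))
  map_one' := by ext <;> simp
  map_mul' g h := by ext <;> simp [mul_assoc]

@[simp]
theorem mulPerm_apply (h : H) (p : X × FreeGroup ι) :
    mulPerm σ π h p = (σ h p.1, π h * p.2) := rfl

/-- The action on the edges of copies of the Cayley tree. -/
def edgePerm : H →* Equiv.Perm (ι × X × FreeGroup ι) where
  toFun h := (Equiv.refl ι).prodCongr (mulPerm σ π h)
  map_one' := by ext <;> simp
  map_mul' g h := by ext <;> simp

@[simp]
theorem edgePerm_apply (h : H) (p : ι × X × FreeGroup ι) :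
    edgePerm σ π h p = (p.1, σ h p.2.1, π h * p.2.2) := rfl

/-- The boundary map of copies of the Cayley tree of a free group. -/
noncomputable def boundary : perm k (edgePerm σ π) ⟶ perm k (mulPerm σ π) :=
  permLift _ (fun p => (Finsupp.single (p.2.1, p.2.2 * FreeGroup.of p.1) 1 -
    Finsupp.single p.2 1 : X × FreeGroup ι →₀ k)) fun h p => by
      rw [map_sub, perm_ρ_single, perm_ρ_single]
      simp [mul_assoc]

/-- The augmentation collapsing each copy of the Cayley tree. -/
noncomputable def collapse : perm k (mulPerm σ π) ⟶ perm k σ :=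
  permLift _ (fun p => (Finsupp.single p.1 1 : X →₀ k)) fun h p => by
    rw [perm_ρ_single, mulPerm_apply]

theorem boundary_single (i : ι) (x : X) (u : FreeGroup ι) :
    (boundary σ π).hom (Finsupp.single (i, x, u) 1) =
      (Finsupp.single (x, u * FreeGroup.of i) 1 - Finsupp.single (x, u) 1 :
        X × FreeGroup ι →₀ k) := by
  rw [boundary, permLift_single, one_smul]

theorem collapse_single (x : X) (u : FreeGroup ι) :
    (collapse σ π).hom (Finsupp.single (x, u) 1) = (Finsupp.single x 1 : X →₀ k) := by
  rw [collapse, permLift_single, one_smul]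

theorem boundary_comp_collapse : boundary (k := k) σ π ≫ collapse σ π = 0 := by
  refine perm_hom_ext _ fun ⟨i, x, u⟩ => ?_
  rw [hom_comp, Representation.IntertwiningMap.comp_apply, boundary_single, map_sub,
    collapse_single, collapse_single, sub_self]
  rfl

/-- The augmented chain complex of copies of the Cayley tree of a free group. -/
noncomputable def cayleyComplex (k : Type) [CommRing k] {H : Type} [Group H] {X : Type}
    (σ : H →* Equiv.Perm X) {ι : Type} (π : H →* FreeGroup ι) : ShortComplex (Rep.{0} k H) :=
  ShortComplex.mk _ _ (boundary_comp_collapse (k := k) σ π)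

/-- The tree is contractible: `s` sends a vertex to the path from the base point, and `t` includes
the base points. This `k`-linear splitting need not be equivariant. -/
theorem shortExact_cayleyComplex : (cayleyComplex k σ π).ShortExact := by
  obtain ⟨D, hD1, hD⟩ := FreeGroup.exists_primitive (M := X → (ι × X × FreeGroup ι →₀ k))
    fun i u x => Finsupp.single (i, x, u) 1
  let s : (X × FreeGroup ι →₀ k) →ₗ[k] (ι × X × FreeGroup ι →₀ k) :=
    Finsupp.linearCombination k fun p => D p.2 p.1
  let t : (X →₀ k) →ₗ[k] (X × FreeGroup ι →₀ k) := Finsupp.lmapDomain k k fun x => (x, 1)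
  have hs (x : X) (u : FreeGroup ι) : s (Finsupp.single (x, u) 1) = D u x := by simp [s]
  have ht (x : X) : t (Finsupp.single x 1) = Finsupp.single (x, 1) 1 := by simp [t]
  let b : (ι × X × FreeGroup ι →₀ k) →ₗ[k] (X × FreeGroup ι →₀ k) :=
    (boundary σ π).hom.toLinearMap
  let c : (X × FreeGroup ι →₀ k) →ₗ[k] (X →₀ k) := (collapse σ π).hom.toLinearMap
  have hb i x u : b (Finsupp.single (i, x, u) 1) = _ := boundary_single σ π i x u
  have hc x u : c (Finsupp.single (x, u) 1) = _ := collapse_single σ π x u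
  have hsb : s ∘ₗ b = LinearMap.id := by
    refine Finsupp.lhom_ext' fun ⟨i, x, u⟩ => LinearMap.ext_ring ?_
    simp [hb, hs, hD]
  have hct : c ∘ₗ t = LinearMap.id := by
    refine Finsupp.lhom_ext' fun x => LinearMap.ext_ring ?_
    simp only [LinearMap.comp_apply, Finsupp.lsingle_apply, ht, hc, LinearMap.id_apply]
  have hbs : b ∘ₗ s + t ∘ₗ c = LinearMap.id := by
    refine Finsupp.lhom_ext' fun ⟨x, u⟩ => LinearMap.ext_ring ?_
    simp only [LinearMap.comp_apply, Finsupp.lsingle_apply, ht, hc, LinearMap.id_apply, hs,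
      LinearMap.add_apply]
    induction u using FreeGroup.induction_mul_of with
    | one => simp [hD1]
    | step u i =>
      -- Crossing an edge changes both sides by the boundary of that edge.
      rw [hD, Pi.add_apply, map_add, hb, ← sub_eq_zero, ← sub_eq_zero (b := Finsupp.single (x, u) 1)]
      refine Eq.congr_left ?_
      abel
  exact
    { exact := by
        refine (ShortComplex.exact_map_iff_of_faithful _
          (forget₂ (Rep.{0} k H) (ModuleCat.{0} k))).1 ?_
        refine (ShortComplex.moduleCat_exact_iff _).2 fun y hy => ⟨s y, ?_⟩
        have h1 : b (s y) + t (c y) = y := LinearMap.congr_fun hbs y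
        have h2 : c y = 0 := hy
        rw [h2, map_zero, add_zero] at h1
        exact h1
      mono_f := (mono_iff_injective _).2
        (Function.LeftInverse.injective (g := s) (LinearMap.congr_fun hsb))
      epi_g := (epi_iff_surjective _).2
        (Function.RightInverse.surjective (g := t) (LinearMap.congr_fun hct)) }

end Cayley

/-- If `X × F ^ n` is a free `H`-set, where `H` acts on each of the `n` free groups by translation
through a homomorphism, then `k[X]` has projective dimension at most `n`. -/
theorem hasProjectiveDimensionLE_perm {ι : Type} (n : ℕ) {X : Type} (σ : H →* Equiv.Perm X)
    (π : Fin n → H →* FreeGroup ι) (hfree : ∀ h x, σ h x = x → (∀ i, π i h = 1) → h = 1) :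
    HasProjectiveDimensionLE (perm k σ) n := by
  induction n generalizing X with
  | zero =>
    rw [← projective_iff_hasProjectiveDimensionLE_zero]
    exact projective_perm_of_free σ fun h x hx => hfree h x hx (fun i => i.elim0)
  | succ n ih =>
    have hmul : HasProjectiveDimensionLE (perm k (mulPerm σ (π 0))) n :=
      ih _ (fun i => π i.succ) fun h p hp hi => by
        rw [mulPerm_apply, Prod.ext_iff] at hp
        exact hfree h p.1 hp.1 (Fin.cases (by simpa using hp.2) hi)
    have hedge : HasProjectiveDimensionLE (perm k (edgePerm σ (π 0))) n :=
      ih _ (fun i => π i.succ) fun h p hp hi => by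
        rw [edgePerm_apply, Prod.ext_iff, Prod.ext_iff] at hp
        exact hfree h p.2.1 hp.2.1 (Fin.cases (by simpa using hp.2.2) hi)
    exact (shortExact_cayleyComplex σ (π 0)).hasProjectiveDimensionLT_X₃ (n + 1) hedge
      (@hasProjectiveDimensionLT_of_ge _ _ _ _ (n + 1) _ (by lia) hmul)

/-- The permutation representation on a point is the trivial representation. -/
noncomputable def permUnitIso : perm k (1 : H →* Equiv.Perm Unit) ≅ Rep.trivial k H k :=
  Rep.mkIso (Representation.Equiv.mk (Finsupp.uniqueLinearEquiv k k ()) fun h => by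
    refine Finsupp.lhom_ext' fun x => LinearMap.ext_ring ?_
    simp)

end PermRep

/-! ### Nonvanishing of `Ext` for commutative groups -/

section Commutative

variable {k : Type} [CommRing k] {A : Type} [CommGroup A]

/-- Elements of a commutative group act on `Ext M N n` in the same way through `M` and `N`. -/
theorem ext_applyAsHom_comm [HasExt.{0} (Rep.{0} k A)] (t : A) {M N : Rep.{0} k A} {n : ℕ}
    (e : Ext M N n) :
    (Ext.mk₀ (M.applyAsHom t)).comp e (zero_add n) =
      e.comp (Ext.mk₀ (N.applyAsHom t)) (add_zero n) := by
  induction n generalizing M with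
  | zero =>
    obtain ⟨f, rfl⟩ := Ext.homEquiv₀.symm.surjective e
    simp [applyAsHom_comm]
  | succ n ih =>
    obtain ⟨⟨P, f⟩⟩ := EnoughProjectives.presentation M
    let S : ShortComplex (Rep.{0} k A) := ShortComplex.mk _ _ (Limits.kernel.condition f)
    have hS : S.ShortExact := { exact := ShortComplex.exact_kernel f }
    obtain ⟨x, rfl⟩ := Ext.contravariant_sequence_exact₃ hS _ e
      (Ext.eq_zero_of_projective _) (add_comm 1 n)
    let φ : S ⟶ S :=
      { τ₁ := S.X₁.applyAsHom t
        τ₂ := S.X₂.applyAsHom t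
        τ₃ := S.X₃.applyAsHom t
        comm₁₂ := applyAsHom_comm _ _
        comm₂₃ := applyAsHom_comm _ _ }
    have key := ShortComplex.ShortExact.extClass_naturality hS hS φ
    have h1 : (Ext.mk₀ (S.X₃.applyAsHom t)).comp (hS.extClass.comp x (add_comm 1 n))
        (zero_add (n + 1)) = (hS.extClass.comp (Ext.mk₀ (S.X₁.applyAsHom t)) (add_zero 1)).comp x
          (add_comm 1 n) := by
      rw [key, Ext.comp_assoc _ _ _ (zero_add 1) (add_comm 1 n) (by lia)]
    refine h1.trans ?_
    rw [Ext.comp_assoc _ _ _ (add_zero 1) (zero_add n) (by lia), ih,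
      Ext.comp_assoc _ _ _ (add_comm 1 n) (add_zero n) (by lia)]

theorem applyAsHom_trivial (t : A) : (Rep.trivial k A k).applyAsHom t = 𝟙 _ := by
  ext : 2
  exact LinearMap.ext fun x => by rfl

/-- The projection from the edges of copies of the Cayley tree to their initial vertices. -/
noncomputable def edgeSource {H : Type} [Group H] {X : Type} (σ : H →* Equiv.Perm X) {ι : Type}
    (π : H →* FreeGroup ι) : perm k (edgePerm σ π) ⟶ perm k (mulPerm σ π) :=
  permLift _ (fun p => (Finsupp.single p.2 1 : X × FreeGroup ι →₀ k)) fun h p => by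
    rw [perm_ρ_single]; rfl

/-- On a line, `t` carries the source of each edge to its target. -/
theorem boundary_eq {X : Type} (σ : A →* Equiv.Perm X) (t : A) (π : A →* FreeGroup Unit)
    (ht : σ t = 1) (hπ : π t = FreeGroup.of ()) :
    boundary (k := k) σ π = edgeSource σ π ≫ (applyAsHom _ t - 𝟙 _) := by
  refine perm_hom_ext _ fun ⟨i, x, u⟩ => ?_
  have hp : (edgeSource σ π).hom (Finsupp.single (i, x, u) 1) =
      (Finsupp.single (x, u) 1 : X × FreeGroup Unit →₀ k) :=
    (permLift_single _ _ _ _ _).trans (one_smul _ _)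
  have hcomm : u * FreeGroup.of i = FreeGroup.of () * u := mul_comm' _ _
  have hsub (v : (perm k (mulPerm σ π)).V) :
      (applyAsHom _ t - 𝟙 (perm k (mulPerm σ π))).hom v = (perm k (mulPerm σ π)).ρ t v - v := rfl
  rw [boundary_single, hom_comp, Representation.IntertwiningMap.comp_apply, hp, hsub,
    perm_ρ_single, mulPerm_apply, ht, hπ, hcomm]
  rfl

/-- The action of `t` on `Ext` can be moved to the trivial coefficients, so `t - 1` induces zero. -/
theorem boundary_comp_ext_eq_zero [HasExt.{0} (Rep.{0} k A)] {X : Type} (σ : A →* Equiv.Perm X)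
    (t : A) (π : A →* FreeGroup Unit) (ht : σ t = 1) (hπ : π t = FreeGroup.of ()) {n : ℕ}
    (e : Ext (perm k (mulPerm σ π)) (Rep.trivial k A k) n) :
    (Ext.mk₀ (boundary σ π)).comp e (zero_add n) = 0 := by
  have h1 : (Ext.mk₀ ((perm k (mulPerm σ π)).applyAsHom t - 𝟙 _)).comp e (zero_add n) = 0 := by
    rw [sub_eq_add_neg, Ext.mk₀_add, Ext.mk₀_neg, Ext.add_comp, Ext.neg_comp,
      ext_applyAsHom_comm, applyAsHom_trivial, Ext.comp_mk₀_id, Ext.mk₀_id_comp,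
      add_neg_cancel]
  rw [boundary_eq σ t π ht hπ, ← Ext.mk₀_comp_mk₀,
    Ext.comp_assoc _ _ _ (zero_add 0) (zero_add n) (by lia), h1, Ext.comp_zero]

/-- If the elements `t i` of a commutative group `A` act trivially on a nonempty `A`-set `X` and are
dual to homomorphisms to the infinite cyclic group, then `Ext (k[X]) k n` is nonzero. -/
theorem exists_ext_perm_ne_zero [Nontrivial k] [HasExt.{0} (Rep.{0} k A)] (n : ℕ) {X : Type}
    [Nonempty X] (σ : A →* Equiv.Perm X) (t : Fin n → A) (π : Fin n → A →* FreeGroup Unit)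
    (ht : ∀ i, σ (t i) = 1) (hπ : ∀ i, π i (t i) = FreeGroup.of ())
    (hπ' : ∀ i j, i ≠ j → π i (t j) = 1) :
    ∃ e : Ext (perm k σ) (Rep.trivial k A k) n, e ≠ 0 := by
  induction n generalizing X with
  | zero =>
    let f : perm k σ ⟶ Rep.trivial k A k := permLift σ (fun _ => (1 : k)) fun h x => by simp
    refine ⟨Ext.mk₀ f, fun h => ?_⟩
    rw [Ext.mk₀_eq_zero_iff] at h
    obtain ⟨x⟩ := ‹Nonempty X›
    have h1 : f.hom (Finsupp.single x 1) = (1 : k) • (1 : k) := permLift_single σ _ _ x 1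
    rw [h] at h1
    simp at h1
  | succ n ih =>
    have := ih (edgePerm σ (π 0)) (fun i => t i.succ) (fun i => π i.succ) (fun i => ?_)
      (fun i => hπ _) (fun i j hij => hπ' _ _ (by simpa using hij))
    · obtain ⟨e, he⟩ := this
      have hS := shortExact_cayleyComplex (k := k) σ (π 0)
      -- If this product vanished, `e` would be pulled back along the boundary map, hence zero.
      refine ⟨hS.extClass.comp e (add_comm 1 n), fun h0 => he ?_⟩
      obtain ⟨e', rfl⟩ := Ext.contravariant_sequence_exact₁ hS _ e _ h0
      exact boundary_comp_ext_eq_zero σ (t 0) (π 0) (ht 0) (hπ 0) e'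
    · ext p <;> simp [ht, hπ' 0 i.succ (Fin.succ_ne_zero i).symm]

end Commutative

end Rep

open Rep in
/-- The cohomological dimension of a group acting on `n` trees through homomorphisms to free groups
with trivial common kernel is at most `n`. -/
theorem cohomologicalDimension_le_of_freeGroup {H : Type} [Group H] {ι : Type} (n : ℕ)
    (π : Fin n → H →* FreeGroup ι) (hπ : ∀ h, (∀ i, π i h = 1) → h = 1) :
    cohomologicalDimension H ≤ n := by
  rw [cohomologicalDimension, ← projectiveDimension_eq_of_iso permUnitIso,
    projectiveDimension_le_iff]
  exact hasProjectiveDimensionLE_perm n _ π fun h _ _ => hπ h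

open Rep in
theorem le_cohomologicalDimension_of_dual {A : Type} [CommGroup A] (n : ℕ)
    (t : Fin n → A) (π : Fin n → A →* FreeGroup Unit) (hπ : ∀ i, π i (t i) = FreeGroup.of ())
    (hπ' : ∀ i j, i ≠ j → π i (t j) = 1) :
    n ≤ cohomologicalDimension A := by
  have : HasExt.{0} (Rep.{0} ℤ A) := hasExt_of_enoughProjectives _
  rw [cohomologicalDimension, ← projectiveDimension_eq_of_iso permUnitIso,
    projectiveDimension_ge_iff]
  intro h
  obtain ⟨e, he⟩ := exists_ext_perm_ne_zero (k := ℤ) n (1 : A →* Equiv.Perm Unit) t π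
    (fun _ => rfl) hπ hπ'
  exact he (Ext.eq_zero_of_hasProjectiveDimensionLT e n le_rfl)

theorem CategoryTheory.Functor.hasProjectiveDimensionLT_obj {C D : Type*} [Category* C] [Category* D]
    [Abelian C] [Abelian D] [EnoughProjectives C] (F : C ⥤ D) [F.PreservesZeroMorphisms]
    [F.PreservesProjectiveObjects]
    (hF : ∀ S : ShortComplex C, S.ShortExact → (S.map F).ShortExact) (n : ℕ) (M : C)
    [HasProjectiveDimensionLT M n] : HasProjectiveDimensionLT (F.obj M) n := by
  cases n with
  | zero =>
    exact (F.map_isZero (isZero_of_hasProjectiveDimensionLT_zero M)).hasProjectiveDimensionLT_zero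
  | succ n =>
    induction n generalizing M with
    | zero =>
      exact projective_iff_hasProjectiveDimensionLT_one.1 (F.projective_obj_of_projective
        (projective_iff_hasProjectiveDimensionLT_one.2 ‹_›))
    | succ n ih =>
      obtain ⟨⟨P, f⟩⟩ := EnoughProjectives.presentation M
      have hS : (ShortComplex.mk _ _ (Limits.kernel.condition f)).ShortExact :=
        { exact := ShortComplex.exact_kernel f }
      have := (hS.hasProjectiveDimensionLT_X₃_iff n ‹_›).1 ‹_›
      exact ((hF _ hS).hasProjectiveDimensionLT_X₃_iff n (F.projective_obj P)).2 (ih _)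

theorem le_cohomologicalDimension_of_subgroup {G : Type} [Group G] (S : Subgroup G) {n : ℕ}
    (h : n ≤ cohomologicalDimension S) : n ≤ cohomologicalDimension G := by
  rw [cohomologicalDimension, projectiveDimension_ge_iff] at h ⊢
  exact fun _ => h ((Rep.resFunctor S.subtype).hasProjectiveDimensionLT_obj
    (fun _ hT => (Rep.shortExact_res S.subtype).2 hT) n (Rep.trivial ℤ G ℤ))

/-! ### Commutation in free groups -/

namespace FreeGroup

theorem not_commute_of {α : Type*} {i j : α} (h : i ≠ j) : ¬ Commute (of i) (of j) := by
  intro hc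
  let f : FreeGroup α →* Equiv.Perm (Fin 3) := by
    classical
    exact lift fun x => if x = i then Equiv.swap 0 1 else Equiv.swap 1 2
  have := hc.map f
  simp only [f, lift_apply_of, if_true, if_neg h.symm] at this
  revert this
  unfold Commute SemiconjBy
  decide

/-- Commuting elements of a free group are powers of a common element. -/
theorem exists_zpow_of_commute {α : Type*} {g h : FreeGroup α} (hc : Commute g h) :
    ∃ (t : FreeGroup α) (m n : ℤ), g = t ^ m ∧ h = t ^ n := by
  let S := Subgroup.closure {g, h}
  have hS : IsMulCommutative S := by
    refine Subgroup.isMulCommutative_closure ?_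
    rintro x (rfl | rfl) y (rfl | rfl)
    exacts [rfl, hc, hc.symm, rfl]
  let e := IsFreeGroup.toFreeGroup S
  have hsub : Subsingleton (IsFreeGroup.Generators S) := by
    refine ⟨fun i j => ?_⟩
    by_contra hij
    refine not_commute_of hij ?_
    have := (show Commute (e.symm (of i)) (e.symm (of j)) from mul_comm' _ _).map e
    simpa using this
  have hcyc : IsCyclic S := by
    rw [e.isCyclic]
    rcases isEmpty_or_nonempty (IsFreeGroup.Generators S) with hE | ⟨⟨x⟩⟩
    · infer_instance
    · have := uniqueOfSubsingleton x
      infer_instance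
  obtain ⟨t, ht⟩ := hcyc.exists_generator
  obtain ⟨m, hm⟩ := ht ⟨g, Subgroup.subset_closure (by simp)⟩
  obtain ⟨n, hn⟩ := ht ⟨h, Subgroup.subset_closure (by simp)⟩
  exact ⟨t, m, n, by simpa using (congrArg Subtype.val hm).symm,
    by simpa using (congrArg Subtype.val hn).symm⟩

/-- Nontrivial powers of a generator and of its conjugate by another generator are distinct. -/
theorem zpow_of_ne_conj {m n : ℤ} (hm : m ≠ 0) :
    (of 0 : FreeGroup (Fin 2)) ^ m ≠ of 1 * of 0 ^ n * (of 1)⁻¹ := by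
  intro h
  -- The first generator shifts one coordinate and the second swaps the two, so the conjugate shifts
  -- the other coordinate.
  let f : FreeGroup (Fin 2) →* Equiv.Perm (ℤ × ℤ) :=
    lift ![(Equiv.addRight (1 : ℤ)).prodCongr (Equiv.refl ℤ), Equiv.prodComm ℤ ℤ]
  have hf (k : ℤ) (p : ℤ × ℤ) : f (of 0 ^ k) p = (p.1 + k, p.2) := by
    induction k generalizing p with
    | zero => simp
    | succ k ih =>
      rw [zpow_add_one, _root_.map_mul, Equiv.Perm.mul_apply, ih]
      simp [f]; ring
    | pred k ih =>
      rw [zpow_sub_one, _root_.map_mul, Equiv.Perm.mul_apply, ih]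
      simp [f, Equiv.Perm.inv_def]; ring
  have h0 := DFunLike.congr_fun (congrArg f h) (0, 0)
  rw [hf, _root_.map_mul, _root_.map_mul, Equiv.Perm.mul_apply, Equiv.Perm.mul_apply, hf] at h0
  simp [f, Equiv.Perm.inv_def] at h0
  exact hm h0.1

/-- A nontrivial element of the free group of rank two does not commute with both a nontrivial power
of a generator and its conjugate by the other generator. -/
theorem not_commute_or_not_commute_conj {g : FreeGroup (Fin 2)} (hg : g ≠ 1) {k : ℤ} (hk : k ≠ 0) :
    ¬ Commute g (of 0 ^ k) ∨ ¬ Commute g (of 1 * of 0 ^ k * (of 1)⁻¹) := by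
  by_contra! hcon
  obtain ⟨t, m, n, h1, h2⟩ := exists_zpow_of_commute hcon.1
  obtain ⟨s, p, q, h3, h4⟩ := exists_zpow_of_commute hcon.2
  have ne_zero {u v : FreeGroup (Fin 2)} {l : ℤ} (hu : u ≠ 1) (h : u = v ^ l) : l ≠ 0 := by
    rintro rfl
    exact hu (by simpa using h)
  have hm := ne_zero hg h1
  have hp := ne_zero hg h3
  have ha : (of 0 : FreeGroup (Fin 2)) ^ k ≠ 1 := by
    rw [Ne, IsMulTorsionFree.zpow_eq_one_iff_left hk]
    exact of_ne_one 0
  have hq : q ≠ 0 := ne_zero (by simpa using ha) h4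
  refine zpow_of_ne_conj (m := k * (m * q)) (n := k * (p * n)) (by positivity) ?_
  calc (of 0 : FreeGroup (Fin 2)) ^ (k * (m * q)) = g ^ (n * q) := by
        rw [zpow_mul, h2, h1, ← zpow_mul, ← zpow_mul]; congr 1; ring
    _ = (of 1 * of 0 ^ k * (of 1)⁻¹) ^ (p * n) := by
        rw [h4, h3, ← zpow_mul, ← zpow_mul]; congr 1; ring
    _ = of 1 * of 0 ^ (k * (p * n)) * (of 1)⁻¹ := by rw [conj_zpow, ← zpow_mul]

end FreeGroup

/-! ### The three-generated subgroup -/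

open FreeGroup

/-- The subgroup of `F₂ ^ d` generated by the diagonal copies of the two generators `a`, `b` and by
the element `(1, a, a ^ 2, …)`. -/
def freePowerSubgroup (d : ℕ) : Subgroup (Fin d → FreeGroup (Fin 2)) :=
  Subgroup.closure {fun _ => of 0, fun _ => of 1, fun i : Fin d => of 0 ^ (i : ℤ)}

variable {d : ℕ}

theorem const_of_mem_freePowerSubgroup (j : Fin 2) :
    (fun _ => of j) ∈ freePowerSubgroup d := by
  refine Subgroup.subset_closure ?_
  fin_cases j <;> simp

theorem isGeneratedByAtMost_freePowerSubgroup (d : ℕ) :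
    IsGeneratedByAtMost (freePowerSubgroup d) 3 := by
  classical
  refine ⟨{fun _ => of 0, fun _ => of 1, fun i : Fin d => of 0 ^ (i : ℤ)}, Finset.card_le_three, ?_⟩
  simp [freePowerSubgroup]

theorem isSubdirectProduct_freePowerSubgroup (d : ℕ) :
    IsSubdirectProduct (freePowerSubgroup d) := by
  intro i
  rw [eq_top_iff, ← closure_range_of, Subgroup.closure_le]
  rintro _ ⟨j, rfl⟩
  exact ⟨_, const_of_mem_freePowerSubgroup j, rfl⟩

theorem exists_mem_freePowerSubgroup_of_notMem (i : Fin d) (T : Finset (Fin d)) (hi : i ∉ T) :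
    ∃ h ∈ freePowerSubgroup d, h i ≠ 1 ∧ ∀ j ∈ T, h j = 1 := by
  induction T using Finset.induction_on with
  | empty => exact ⟨_, const_of_mem_freePowerSubgroup 0, of_ne_one 0, by simp⟩
  | insert j T _ ih =>
    rw [Finset.mem_insert, not_or] at hi
    obtain ⟨h, hh, hhi, hhT⟩ := ih hi.2
    let a : Fin d → FreeGroup (Fin 2) := fun _ => of 0
    let b : Fin d → FreeGroup (Fin 2) := fun _ => of 1
    let z : Fin d → FreeGroup (Fin 2) := fun i => of 0 ^ (i : ℤ)
    have ha : a ∈ freePowerSubgroup d := const_of_mem_freePowerSubgroup 0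
    have hb : b ∈ freePowerSubgroup d := const_of_mem_freePowerSubgroup 1
    have hz : z ∈ freePowerSubgroup d := Subgroup.subset_closure (by simp [z])
    -- `h` fails to commute in coordinate `i` with `u` or with its conjugate by `b`. Both are
    -- trivial at `j`, so the commutator dies on `insert j T` but not at `i`.
    let u := z * (a ^ (j : ℤ))⁻¹
    have hu : u ∈ freePowerSubgroup d := mul_mem hz (inv_mem (zpow_mem ha _))
    have hui (l : Fin d) : u l = of 0 ^ ((l : ℤ) - j) := by simp [u, z, a, zpow_sub]
    have huj : u j = 1 := by simp [hui]
    have hij : ((i : ℤ) - j) ≠ 0 := by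
      have := Fin.val_ne_of_ne hi.1
      lia
    have comm {w : Fin d → FreeGroup (Fin 2)} (hw : w ∈ freePowerSubgroup d) (hwj : w j = 1)
        (hwi : ¬ Commute (h i) (w i)) :
        ∃ h ∈ freePowerSubgroup d, h i ≠ 1 ∧ ∀ l ∈ insert j T, h l = 1 := by
      refine ⟨h * w * h⁻¹ * w⁻¹, mul_mem (mul_mem (mul_mem hh hw) (inv_mem hh)) (inv_mem hw),
        fun h1 => hwi ?_, fun l hl => ?_⟩
      · exact commutatorElement_eq_one_iff_commute.1 h1
      · rcases Finset.mem_insert.1 hl with rfl | hl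
        · simp [hwj]
        · simp [hhT l hl]
    rcases not_commute_or_not_commute_conj hhi hij with h1 | h1
    · exact comm hu huj (by rwa [hui])
    · exact comm (mul_mem (mul_mem hb hu) (inv_mem hb)) (by simp [huj])
        (by simpa [b, hui] using h1)

theorem exists_mulSingle_mem_freePowerSubgroup (i : Fin d) :
    ∃ g : FreeGroup (Fin 2), g ≠ 1 ∧ Pi.mulSingle i g ∈ freePowerSubgroup d := by
  obtain ⟨h, hh, hi, hT⟩ := exists_mem_freePowerSubgroup_of_notMem i (Finset.univ.erase i) (by simp)
  refine ⟨h i, hi, ?_⟩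
  convert hh
  ext j : 1
  by_cases hj : j = i
  · subst hj; simp
  · rw [Pi.mulSingle_eq_of_ne hj, hT j (by simp [hj])]

theorem exists_injective_to_freePowerSubgroup (d : ℕ) :
    ∃ f : Multiplicative (Fin d → ℤ) →* freePowerSubgroup d, Function.Injective f := by
  choose g hg hmem using exists_mulSingle_mem_freePowerSubgroup (d := d)
  let f : Multiplicative (Fin d → ℤ) →* (Fin d → FreeGroup (Fin 2)) :=
    { toFun := fun v i => g i ^ (v.toAdd i)
      map_one' := by ext1 i; simp
      map_mul' := fun v w => by ext1 i; simp [zpow_add] }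
  refine ⟨f.codRestrict (freePowerSubgroup d) fun v => ?_, ?_⟩
  · refine Subgroup.pi_mem_of_mulSingle_mem _ fun i => ?_
    have := zpow_mem (hmem i) (v.toAdd i)
    rwa [← Pi.mulSingle_zpow] at this
  · rw [MonoidHom.injective_codRestrict, injective_iff_map_eq_one]
    intro v hv
    refine Multiplicative.toAdd.injective (funext fun i => ?_)
    by_contra hi
    exact hg i ((IsMulTorsionFree.zpow_eq_one_iff_left hi).1 (congrFun hv i))

theorem le_cohomologicalDimension_of_mulEquiv {A : Type} [Group A]
    (e : A ≃* Multiplicative (Fin d → ℤ)) : d ≤ cohomologicalDimension A := by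
  let : CommGroup A :=
    { mul_comm := fun x y => e.injective (by rw [_root_.map_mul, _root_.map_mul, mul_comm]) }
  let ev (i : Fin d) : Multiplicative (Fin d → ℤ) →* FreeGroup Unit :=
    (zpowersHom _ (of ())).comp (Pi.evalAddMonoidHom (fun _ => ℤ) i).toMultiplicative
  refine le_cohomologicalDimension_of_dual d
    (fun i => e.symm (Multiplicative.ofAdd (Pi.single i 1))) (fun i => (ev i).comp e.toMonoidHom)
    (fun i => ?_) (fun i j hij => ?_)
  · simp [ev]
  · simp [ev, hij]

theorem proposition1p1 (d : ℕ) :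
    ∃ H : Subgroup (Fin d → FreeGroup (Fin 2)),
      IsGeneratedByAtMost H 3 ∧
      IsSubdirectProduct H ∧
      (∃ A : Subgroup H, Nonempty (A ≃* Multiplicative (Fin d → ℤ))) ∧
      cohomologicalDimension H = (d : WithBot ℕ∞) := by
  obtain ⟨f, hf⟩ := exists_injective_to_freePowerSubgroup d
  have e := (f.ofInjective hf).symm
  refine ⟨freePowerSubgroup d, isGeneratedByAtMost_freePowerSubgroup d,
    isSubdirectProduct_freePowerSubgroup d, ⟨f.range, ⟨e⟩⟩, le_antisymm ?_ ?_⟩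
  · exact cohomologicalDimension_le_of_freeGroup d
      (fun i => (Pi.evalMonoidHom _ i).comp (freePowerSubgroup d).subtype)
      fun h hh => Subtype.ext (funext hh)
  · exact le_cohomologicalDimension_of_subgroup f.range (le_cohomologicalDimension_of_mulEquiv e)
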